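/- For a positive integer $n$ let $Z(n)=\sum \frac{1}{ijk}$, where the sum is over all ordered triples $(i,j,k)$ of positive integers with $i+j+k=n$ and each of $i,j,k$ coprime to $n$. Let $B_k$ denote the Bernoulli numbers, given by $B_0=1$ and $\sum_{i=0}^{n}\binom{n+1}{i}B_i=0$ for $n\ge 1$. Let $p,q$ be distinct odd primes and $\alpha,\beta$ positive integers. Then $$Z(p^{\alpha}q^{\beta})\equiv 2(2-q)\left(1-\frac{1}{q^{3}}\right)p^{\alpha-1}q^{\beta-1}B_{p-3}\pmod{p^{\alpha}}.$$ Here a congruence $x\equiv y\pmod m$ between rational numbers means that $x$ and $y$ have denominators coprime to $m$ and that $m$ divides the numerator of $x-y$ in lowest terms. -/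

import Mathlib

/-- `Z(n) = ∑ 1 / (i j k)`, a rational number: the sum over all ordered triples `(i, j, k)` of
positive integers, each prime to `n`, with `i + j + k = n`. -/
def harmonicZ (n : ℕ) : ℚ :=
  ∑ t ∈ (Finset.Icc 1 n ×ˢ Finset.Icc 1 n ×ˢ Finset.Icc 1 n).filter
      (fun t : ℕ × ℕ × ℕ => t.1 + t.2.1 + t.2.2 = n ∧
        t.1.Coprime n ∧ t.2.1.Coprime n ∧ t.2.2.Coprime n),
    1 / ((t.1 : ℚ) * (t.2.1 : ℚ) * (t.2.2 : ℚ))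

/-- Congruence modulo `m` of rational numbers that are integral at `m`: the denominators of `x`
and `y` are prime to `m`, and `m` divides the numerator of `x - y` in lowest terms. -/
def RatModEq (m : ℕ) (x y : ℚ) : Prop :=
  x.den.Coprime m ∧ y.den.Coprime m ∧ (m : ℤ) ∣ (x - y).num

/-! Extend 1/i by 0 to the entries not prime to n, so that Z(n) becomes a sum over all triples in
`ZMod M`. If m is odd, M divides N² and mN, and every prime of m divides N, then Z(mN) ≡ mZ(N) mod M
(`tripleSum_mul`). Indeed, split the entries as a + Nx. The residues sum to N or 2N, with m(m+1)/2
or m(m-1)/2 quotient triples; first-order terms in N cancel by symmetry, and a ↦ N - a turns the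
second kind into minus the first. This reduces the theorem to Z(pq) mod p.

With 0⁻¹ = 0, only multiples of q must be excluded there, by inclusion-exclusion. Put D =
`doubleHarmonicMod p` and F = `floorSumMod p q`. Partial fractions give Z(pq) ≡ (6 - 2q - 4q⁻³)D -
6F. Faulhaber's formula gives D = B_{p-3}, Voronoi's congruence gives 3F = (1 - q⁻²)B_{p-3}, and the
resulting coefficient 4 - 2q + 2q⁻² - 4q⁻³ factors as 2(2 - q)(1 - q⁻³). -/

/-! ### Residues of rational numbers -/

/-- The rational number `x`, whose denominator is prime to `m`, has residue `r` modulo `m`. -/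
def ReducesTo (m : ℕ) (x : ℚ) (r : ZMod m) : Prop :=
  ∃ (a : ℤ) (d : ℕ), d.Coprime m ∧ x * d = a ∧ r * d = a

namespace ReducesTo

variable {m : ℕ} {x y : ℚ} {r s : ZMod m}

theorem add (hx : ReducesTo m x r) (hy : ReducesTo m y s) : ReducesTo m (x + y) (r + s) := by
  obtain ⟨a, d, hd, h1, h2⟩ := hx
  obtain ⟨b, e, he, h3, h4⟩ := hy
  refine ⟨a * e + b * d, d * e, hd.mul_left he, ?_, ?_⟩
  · push_cast
    rw [← h1, ← h3]
    ring
  · push_cast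
    rw [← h2, ← h4]
    ring

theorem mul (hx : ReducesTo m x r) (hy : ReducesTo m y s) : ReducesTo m (x * y) (r * s) := by
  obtain ⟨a, d, hd, h1, h2⟩ := hx
  obtain ⟨b, e, he, h3, h4⟩ := hy
  refine ⟨a * b, d * e, hd.mul_left he, ?_, ?_⟩
  · push_cast
    rw [← h1, ← h3]
    ring
  · push_cast
    rw [← h2, ← h4]
    ring

theorem intCast (m : ℕ) (a : ℤ) : ReducesTo m a a := ⟨a, 1, by simp, by simp, by simp⟩

theorem natCast (m : ℕ) (a : ℕ) : ReducesTo m a a := ⟨a, 1, by simp, by simp, by simp⟩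

theorem neg (hx : ReducesTo m x r) : ReducesTo m (-x) (-r) := by
  simpa using (intCast m (-1)).mul hx

theorem sub (hx : ReducesTo m x r) (hy : ReducesTo m y s) : ReducesTo m (x - y) (r - s) := by
  simpa [sub_eq_add_neg] using hx.add hy.neg

theorem pow (hx : ReducesTo m x r) (n : ℕ) : ReducesTo m (x ^ n) (r ^ n) := by
  induction n with
  | zero => simpa using natCast m 1
  | succ n ih => simpa [pow_succ] using ih.mul hx

theorem inv_natCast {d : ℕ} (hd : d.Coprime m) (h0 : d ≠ 0) :
    ReducesTo m (d : ℚ)⁻¹ (d : ZMod m)⁻¹ := by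
  refine ⟨1, d, hd, by field_simp; simp, ?_⟩
  rw [mul_comm, ZMod.coe_mul_inv_eq_one d hd]
  simp

theorem sum {ι : Type*} {t : Finset ι} {f : ι → ℚ} {g : ι → ZMod m}
    (h : ∀ i ∈ t, ReducesTo m (f i) (g i)) :
    ReducesTo m (∑ i ∈ t, f i) (∑ i ∈ t, g i) := by
  classical
  induction t using Finset.induction_on with
  | empty => simpa using natCast m 0
  | insert a t ha ih =>
    rw [Finset.sum_insert ha, Finset.sum_insert ha]
    exact (h a (by simp)).add (ih fun i hi => h i (by simp [hi]))

/-- Cross-multiply and cancel the denominators, which are units. This is what carries identities in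
`ℚ` over to `ZMod m`. -/
theorem unique (hx : ReducesTo m x r) (hy : ReducesTo m x s) : r = s := by
  obtain ⟨a, d, hd, h1, h2⟩ := hx
  obtain ⟨b, e, he, h3, h4⟩ := hy
  have h : a * e = b * d := by
    have : (a : ℚ) * e = b * d := by rw [← h1, ← h3]; ring
    exact_mod_cast this
  have h' : (a : ZMod m) * e = b * d := by exact_mod_cast congrArg (Int.cast : ℤ → ZMod m) h
  have hd' := ZMod.coe_mul_inv_eq_one d hd
  have he' := ZMod.coe_mul_inv_eq_one e he
  calc r = (r * d) * e * ((d : ZMod m)⁻¹ * (e : ZMod m)⁻¹) := by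
        linear_combination (-r) * he' - r * (e * (e : ZMod m)⁻¹) * hd'
    _ = (s * e) * d * ((d : ZMod m)⁻¹ * (e : ZMod m)⁻¹) := by rw [h2, h4, h']
    _ = s := by linear_combination s * he' + s * (e * (e : ZMod m)⁻¹) * hd'

theorem den_coprime (hx : ReducesTo m x r) : x.den.Coprime m := by
  obtain ⟨a, d, hd, h1, -⟩ := hx
  refine Nat.Coprime.of_dvd_left ?_ hd
  have h : x.num * d = a * x.den := by
    have : (x.num : ℚ) * d = a * x.den := by
      rw [← h1]
      nth_rewrite 2 [← Rat.num_div_den x]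
      field_simp
    exact_mod_cast this
  have h2 : (x.den : ℤ) ∣ x.num * d := ⟨a, by rw [h]; ring⟩
  have h3 : x.den ∣ x.num.natAbs * d := by
    simpa [Int.natAbs_mul] using Int.natAbs_dvd_natAbs.mpr h2
  exact x.reduced.symm.dvd_of_dvd_mul_left h3

theorem exists_of_den_coprime (h : x.den.Coprime m) : ∃ r, ReducesTo m x r := by
  refine ⟨(x.num : ZMod m) * (x.den : ZMod m)⁻¹, x.num, x.den, h, Rat.mul_den_eq_num x, ?_⟩
  linear_combination (x.num : ZMod m) * ZMod.coe_mul_inv_eq_one x.den h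

theorem num_dvd (h : ReducesTo m x 0) : (m : ℤ) ∣ x.num := by
  have hd := h.den_coprime
  have h2 := (natCast m x.den).mul h
  rw [mul_comm, Rat.mul_den_eq_num] at h2
  have := h2.unique (intCast m x.num)
  rw [mul_zero] at this
  exact (ZMod.intCast_zmod_eq_zero_iff_dvd _ _).1 this.symm

theorem of_num_dvd (h : x.den.Coprime m) (h2 : (m : ℤ) ∣ x.num) : ReducesTo m x 0 :=
  ⟨x.num, x.den, h, Rat.mul_den_eq_num x, by
    rw [(ZMod.intCast_zmod_eq_zero_iff_dvd _ _).2 h2, zero_mul]⟩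

end ReducesTo

theorem ratModEq_iff {m : ℕ} {x y : ℚ} :
    RatModEq m x y ↔ ∃ r, ReducesTo m x r ∧ ReducesTo m y r := by
  constructor
  · rintro ⟨h1, h2, h3⟩
    obtain ⟨r, hr⟩ := ReducesTo.exists_of_den_coprime h1
    obtain ⟨s, hs⟩ := ReducesTo.exists_of_den_coprime h2
    have hrs := hr.sub hs
    have := (ReducesTo.of_num_dvd hrs.den_coprime h3).unique hrs
    exact ⟨r, hr, by rwa [sub_eq_zero.1 this.symm]⟩
  · rintro ⟨r, h1, h2⟩
    refine ⟨h1.den_coprime, h2.den_coprime, ReducesTo.num_dvd ?_⟩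
    simpa using h1.sub h2

theorem RatModEq.trans {m : ℕ} {x y z : ℚ} (h1 : RatModEq m x y) (h2 : RatModEq m y z) :
    RatModEq m x z := by
  obtain ⟨r, hx, hy⟩ := ratModEq_iff.1 h1
  obtain ⟨s, hy', hz⟩ := ratModEq_iff.1 h2
  exact ratModEq_iff.2 ⟨r, hx, by rwa [hy.unique hy']⟩

theorem RatModEq.natCast_mul {m : ℕ} {x y : ℚ} (k : ℕ) (h : RatModEq m x y) :
    RatModEq m (k * x) (k * y) := by
  obtain ⟨r, hx, hy⟩ := ratModEq_iff.1 h
  exact ratModEq_iff.2 ⟨k * r, (ReducesTo.natCast m k).mul hx, (ReducesTo.natCast m k).mul hy⟩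

/-- As `k ∣ m`, denominators prime to `m` are prime to `m * k`, so the factor `k` gained by the
difference strengthens the modulus. -/
theorem RatModEq.natCast_mul_lift {m k : ℕ} {x y : ℚ} (hk : k ∣ m) (h : RatModEq m x y) :
    RatModEq (m * k) (k * x) (k * y) := by
  obtain ⟨r, hx, hy⟩ := ratModEq_iff.1 h
  have hlift : ∀ {d : ℕ}, d.Coprime m → d.Coprime (m * k) := fun {d} hd =>
    hd.mul_right (hd.of_dvd_right hk)
  obtain ⟨a, ha⟩ := ReducesTo.exists_of_den_coprime (hlift hx.den_coprime)
  obtain ⟨b, hb⟩ := ReducesTo.exists_of_den_coprime (hlift hy.den_coprime)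
  have hxy := hx.sub hy
  rw [sub_self] at hxy
  obtain ⟨c, hc⟩ := hxy.num_dvd
  have hz : ReducesTo (m * k) (k * (x - y)) 0 := by
    refine ⟨(m * k : ℕ) * c, (x - y).den, hlift hxy.den_coprime, ?_, by
      rw [Int.cast_mul, Int.cast_natCast, ZMod.natCast_self, zero_mul, zero_mul]⟩
    rw [mul_assoc, Rat.mul_den_eq_num, hc]
    push_cast
    ring
  have hk' := ReducesTo.natCast (m * k) k
  have h0 := ((hk'.mul ha).sub (hk'.mul hb)).unique (by rwa [← mul_sub])
  exact ratModEq_iff.2 ⟨k * a, hk'.mul ha, by rw [sub_eq_zero.1 h0]; exact hk'.mul hb⟩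

/-! ### Sums over triples -/

/-- The ordered triples of natural numbers with sum `n`. -/
def triples (n : ℕ) : Finset (ℕ × ℕ × ℕ) :=
  (Finset.range (n + 1) ×ˢ Finset.range (n + 1) ×ˢ Finset.range (n + 1)).filter
    fun t => t.1 + t.2.1 + t.2.2 = n

@[simp]
theorem mem_triples {n : ℕ} {t : ℕ × ℕ × ℕ} : t ∈ triples n ↔ t.1 + t.2.1 + t.2.2 = n := by
  simp only [triples, Finset.mem_filter, Finset.mem_product, Finset.mem_range]
  omega

/-- `∑ g i * g j * g k` over all `i + j + k = n`. -/
def tripleSum {R : Type*} [CommRing R] (g : ℕ → R) (n : ℕ) : R :=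
  ∑ t ∈ triples n, g t.1 * g t.2.1 * g t.2.2

/-- The inverse of `i` in `ZMod m` if `i` is prime to `n`, and `0` otherwise. -/
def coprimeInv (m n i : ℕ) : ZMod m := if i.Coprime n then (i : ZMod m)⁻¹ else 0

/-- Triples with a zero entry add nothing: 0 is not prime to `n` when `n > 1`. -/
theorem reducesTo_harmonicZ {m n : ℕ} (hmn : ∀ i : ℕ, i.Coprime n → i.Coprime m)
    (hn : 1 < n) :
    ReducesTo m (harmonicZ n) (tripleSum (coprimeInv m n) n) := by
  have h : tripleSum (coprimeInv m n) n =
      ∑ t ∈ (Finset.Icc 1 n ×ˢ Finset.Icc 1 n ×ˢ Finset.Icc 1 n).filter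
      (fun t : ℕ × ℕ × ℕ => t.1 + t.2.1 + t.2.2 = n ∧
        t.1.Coprime n ∧ t.2.1.Coprime n ∧ t.2.2.Coprime n),
      coprimeInv m n t.1 * coprimeInv m n t.2.1 * coprimeInv m n t.2.2 := by
    refine (Finset.sum_subset ?_ ?_).symm
    · intro t ht
      simp only [Finset.mem_filter] at ht
      exact mem_triples.2 ht.2.1
    · rintro ⟨i, j, k⟩ ht hnot
      have hpos : ∀ {i : ℕ}, i.Coprime n → 1 ≤ i := fun {i} hi => by
        rcases Nat.eq_zero_or_pos i with rfl | h
        · rw [Nat.coprime_zero_left] at hi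
          omega
        · exact h
      simp only [mem_triples] at ht
      simp only [Finset.mem_filter, Finset.mem_product, Finset.mem_Icc] at hnot
      by_cases hi : i.Coprime n
      · by_cases hj : j.Coprime n
        · by_cases hk : k.Coprime n
          · have := hpos hi
            have := hpos hj
            have := hpos hk
            exact absurd ⟨by omega, ht, hi, hj, hk⟩ hnot
          · simp [coprimeInv, hk]
        · simp [coprimeInv, hj]
      · simp [coprimeInv, hi]
  rw [h, harmonicZ]
  refine ReducesTo.sum ?_
  rintro ⟨i, j, k⟩ ht
  simp only [Finset.mem_filter, Finset.mem_product, Finset.mem_Icc] at ht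
  obtain ⟨⟨hi0, hj0, hk0⟩, -, hi, hj, hk⟩ := ht
  have key : ∀ {i : ℕ}, 1 ≤ i → i.Coprime n → ReducesTo m (i : ℚ)⁻¹ (coprimeInv m n i) := by
    intro i h0 hi
    rw [coprimeInv, if_pos hi]
    exact ReducesTo.inv_natCast (hmn i hi) (by omega)
  have := ((key hi0.1 hi).mul (key hj0.1 hj)).mul (key hk0.1 hk)
  simpa [one_div, mul_inv, mul_comm, mul_left_comm, mul_assoc] using this

theorem sum_triples {M : Type*} [AddCommMonoid M] (n : ℕ) (f : ℕ × ℕ × ℕ → M) :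
    ∑ t ∈ triples n, f t =
      ∑ i ∈ Finset.range (n + 1), ∑ x ∈ Finset.HasAntidiagonal.antidiagonal (n - i), f (i, x) := by
  rw [Finset.sum_sigma']
  refine Finset.sum_nbij' (fun t => ⟨t.1, t.2⟩) (fun x => (x.1, x.2)) ?_ ?_ ?_ ?_ ?_
  · rintro ⟨i, j, k⟩ h
    simp at h ⊢
    omega
  · rintro ⟨i, j, k⟩ h
    simp at h ⊢
    omega
  · simp
  · simp
  · simp

theorem two_mul_card_triples (n : ℕ) : 2 * (triples n).card = (n + 1) * (n + 2) := by
  have h : (triples n).card = ∑ i ∈ Finset.range (n + 1), (i + 1) := by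
    rw [Finset.card_eq_sum_ones, sum_triples, ← Finset.sum_range_reflect]
    refine Finset.sum_congr rfl fun i hi => ?_
    rw [Finset.mem_range] at hi
    rw [← Finset.card_eq_sum_ones, Finset.Nat.card_antidiagonal]
    omega
  rw [h]
  clear h
  induction n with
  | zero => simp
  | succ n ih =>
    rw [Finset.sum_range_succ, mul_add, ih]
    ring

theorem sum_triples_swap {M : Type*} [AddCommMonoid M] (n : ℕ) (f : ℕ × ℕ × ℕ → M) :
    ∑ t ∈ triples n, f t = ∑ t ∈ triples n, f (t.2.1, t.1, t.2.2) := by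
  refine Finset.sum_nbij' (fun t => (t.2.1, t.1, t.2.2)) (fun t => (t.2.1, t.1, t.2.2))
    ?_ ?_ ?_ ?_ ?_
  all_goals simp
  all_goals omega

theorem sum_triples_swap' {M : Type*} [AddCommMonoid M] (n : ℕ) (f : ℕ × ℕ × ℕ → M) :
    ∑ t ∈ triples n, f t = ∑ t ∈ triples n, f (t.2.2, t.2.1, t.1) := by
  refine Finset.sum_nbij' (fun t => (t.2.2, t.2.1, t.1)) (fun t => (t.2.2, t.2.1, t.1))
    ?_ ?_ ?_ ?_ ?_
  all_goals simp
  all_goals omega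

theorem three_mul_sum_triples_fst (n : ℕ) :
    3 * ∑ t ∈ triples n, t.1 = n * (triples n).card := by
  have h1 := sum_triples_swap n fun t => t.1
  have h2 := sum_triples_swap' n fun t => t.1
  have h3 : ∑ t ∈ triples n, (t.1 + t.2.1 + t.2.2) = n * (triples n).card := by
    rw [Finset.sum_congr rfl fun t ht => mem_triples.1 ht]
    simp [mul_comm]
  simp only [Finset.sum_add_distrib] at h3
  simp only at h1 h2
  omega

/-! ### Residues and quotients modulo `N` -/

/-- The ordered triples of positive integers below `N` with sum `n`. -/
def boxTriples (N n : ℕ) : Finset (ℕ × ℕ × ℕ) :=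
  (triples n).filter fun t => (0 < t.1 ∧ t.1 < N) ∧ (0 < t.2.1 ∧ t.2.1 < N) ∧
    (0 < t.2.2 ∧ t.2.2 < N)

theorem mem_boxTriples {N n : ℕ} {t : ℕ × ℕ × ℕ} : t ∈ boxTriples N n ↔
    t.1 + t.2.1 + t.2.2 = n ∧ (0 < t.1 ∧ t.1 < N) ∧ (0 < t.2.1 ∧ t.2.1 < N) ∧
    (0 < t.2.2 ∧ t.2.2 < N) := by
  simp only [boxTriples, Finset.mem_filter, mem_triples]

theorem tripleSum_eq_sum_boxTriples {R : Type*} [CommRing R] {g : ℕ → R} (N : ℕ) (hg : g 0 = 0) :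
    tripleSum g N = ∑ t ∈ boxTriples N N, g t.1 * g t.2.1 * g t.2.2 := by
  have hsub : boxTriples N N ⊆ triples N := Finset.filter_subset _ _
  refine (Finset.sum_subset hsub ?_).symm
  rintro ⟨i, j, k⟩ ht hnot
  simp only [mem_triples] at ht
  simp only [mem_boxTriples] at hnot
  rcases Nat.eq_zero_or_pos i with rfl | hi
  · simp [hg]
  rcases Nat.eq_zero_or_pos j with rfl | hj
  · simp [hg]
  rcases Nat.eq_zero_or_pos k with rfl | hk
  · simp [hg]
  exact absurd ⟨ht, by omega⟩ hnot

/-- Splitting each entry of a triple with sum `m * N` into its residue and quotient modulo `N`. -/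
theorem tripleSum_mul_eq {R : Type*} [CommRing R] {g : ℕ → R} {m N : ℕ} (hN : 0 < N) (hm : 2 ≤ m)
    (hg : ∀ x, g (N * x) = 0) :
    tripleSum g (m * N) = ∑ s ∈ ({1, 2} : Finset ℕ), ∑ t ∈ boxTriples N (s * N),
      ∑ x ∈ triples (m - s),
        g (t.1 + N * x.1) * g (t.2.1 + N * x.2.1) * g (t.2.2 + N * x.2.2) := by
  have h1 : tripleSum g (m * N) = ∑ t ∈ (triples (m * N)).filter
      (fun t => 0 < t.1 % N ∧ 0 < t.2.1 % N ∧ 0 < t.2.2 % N),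
      g t.1 * g t.2.1 * g t.2.2 := by
    refine (Finset.sum_subset (Finset.filter_subset _ _) ?_).symm
    rintro ⟨i, j, k⟩ ht hnot
    have key : ∀ i, i % N = 0 → g i = 0 := fun i hi => by
      obtain ⟨c, rfl⟩ := Nat.dvd_of_mod_eq_zero hi
      exact hg c
    rcases Nat.eq_zero_or_pos (i % N) with hi | hi
    · simp [key _ hi]
    rcases Nat.eq_zero_or_pos (j % N) with hj | hj
    · simp [key _ hj]
    rcases Nat.eq_zero_or_pos (k % N) with hk | hk
    · simp [key _ hk]
    exact absurd (Finset.mem_filter.2 ⟨ht, hi, hj, hk⟩) hnot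
  rw [h1, Finset.sum_sigma', Finset.sum_sigma']
  refine Finset.sum_nbij'
    (fun t => ⟨⟨(t.1 % N + t.2.1 % N + t.2.2 % N) / N, (t.1 % N, t.2.1 % N, t.2.2 % N)⟩,
      (t.1 / N, t.2.1 / N, t.2.2 / N)⟩)
    (fun z => (z.1.2.1 + N * z.2.1, z.1.2.2.1 + N * z.2.2.1, z.1.2.2.2 + N * z.2.2.2))
    ?_ ?_ ?_ ?_ ?_
  · rintro ⟨i, j, k⟩ h
    simp only [Finset.mem_filter, mem_triples] at h
    obtain ⟨hsum, hi, hj, hk⟩ := h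
    have hi' := Nat.mod_lt i hN
    have hj' := Nat.mod_lt j hN
    have hk' := Nat.mod_lt k hN
    have ei := Nat.mod_add_div i N
    have ej := Nat.mod_add_div j N
    have ek := Nat.mod_add_div k N
    have hdvd : N ∣ i % N + j % N + k % N := by
      have h2 : N ∣ (i % N + j % N + k % N) + N * (i / N + j / N + k / N) :=
        ⟨m, by rw [mul_add, mul_add, mul_comm N m]; omega⟩
      exact (Nat.dvd_add_left (dvd_mul_right _ _)).1 h2
    obtain ⟨s, hs⟩ := hdvd
    have hs1 : 0 < s := by
      rcases Nat.eq_zero_or_pos s with rfl | h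
      · omega
      · exact h
    -- Three residues below `N` have sum below `3 * N`.
    have hs2 : s < 3 := by
      by_contra hcon
      have : N * 3 ≤ N * s := Nat.mul_le_mul_left N (by omega)
      omega
    have hquot : s + (i / N + j / N + k / N) = m := by
      have : N * (s + (i / N + j / N + k / N)) = N * m := by
        rw [mul_add, ← hs, mul_add, mul_add, mul_comm N m]
        omega
      exact Nat.eq_of_mul_eq_mul_left hN this
    simp only [Finset.mem_sigma, mem_boxTriples, mem_triples, hs, Nat.mul_div_cancel_left s hN,
      Finset.mem_insert, Finset.mem_singleton]
    exact ⟨⟨by omega, mul_comm _ _, ⟨hi, hi'⟩, ⟨hj, hj'⟩, hk, hk'⟩, by omega⟩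
  · rintro ⟨⟨s, a, b, c⟩, x, y, z⟩ h
    simp only [Finset.mem_sigma, mem_boxTriples, mem_triples, Finset.mem_insert,
      Finset.mem_singleton] at h
    obtain ⟨⟨hs, habc, ha, hb, hc⟩, hxyz⟩ := h
    simp only [Finset.mem_filter, mem_triples, Nat.add_mul_mod_self_left, Nat.mod_eq_of_lt ha.2,
      Nat.mod_eq_of_lt hb.2, Nat.mod_eq_of_lt hc.2]
    refine ⟨?_, ha.1, hb.1, hc.1⟩
    have hm' : m = s + (x + y + z) := by omega
    rw [hm', add_mul, ← habc]
    ring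
  · rintro ⟨i, j, k⟩ -
    simp [Nat.mod_add_div]
  · rintro ⟨⟨s, a, b, c⟩, x, y, z⟩ h
    simp only [Finset.mem_sigma, mem_boxTriples, mem_triples, Finset.mem_insert,
      Finset.mem_singleton] at h
    obtain ⟨⟨hs, habc, ha, hb, hc⟩, hxyz⟩ := h
    simp only [Nat.add_mul_mod_self_left, Nat.mod_eq_of_lt ha.2,
      Nat.mod_eq_of_lt hb.2, Nat.mod_eq_of_lt hc.2, Nat.add_mul_div_left _ _ hN,
      Nat.div_eq_of_lt ha.2, Nat.div_eq_of_lt hb.2, Nat.div_eq_of_lt hc.2, zero_add, habc,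
      Nat.mul_div_cancel s hN]
  · rintro ⟨i, j, k⟩ -
    simp [Nat.mod_add_div]

theorem sum_boxTriples_swap {M : Type*} [AddCommMonoid M] (N n : ℕ) (f : ℕ × ℕ × ℕ → M) :
    ∑ t ∈ boxTriples N n, f t = ∑ t ∈ boxTriples N n, f (t.2.1, t.1, t.2.2) := by
  refine Finset.sum_nbij' (fun t => (t.2.1, t.1, t.2.2)) (fun t => (t.2.1, t.1, t.2.2))
    ?_ ?_ ?_ ?_ ?_
  all_goals simp [mem_boxTriples]
  all_goals omega

theorem sum_boxTriples_swap' {M : Type*} [AddCommMonoid M] (N n : ℕ) (f : ℕ × ℕ × ℕ → M) :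
    ∑ t ∈ boxTriples N n, f t = ∑ t ∈ boxTriples N n, f (t.2.2, t.2.1, t.1) := by
  refine Finset.sum_nbij' (fun t => (t.2.2, t.2.1, t.1)) (fun t => (t.2.2, t.2.1, t.1))
    ?_ ?_ ?_ ?_ ?_
  all_goals simp [mem_boxTriples]
  all_goals omega

/-- The reflection a ↦ N - a replaces the sum 2N by 3N - 2N = N. -/
theorem sum_boxTriples_two_mul {M : Type*} [AddCommMonoid M] (N : ℕ) (f : ℕ × ℕ × ℕ → M) :
    ∑ t ∈ boxTriples N (2 * N), f t =
      ∑ t ∈ boxTriples N N, f (N - t.1, N - t.2.1, N - t.2.2) := by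
  refine Finset.sum_nbij' (fun t => (N - t.1, N - t.2.1, N - t.2.2))
    (fun t => (N - t.1, N - t.2.1, N - t.2.2)) ?_ ?_ ?_ ?_ ?_
  · rintro ⟨i, j, k⟩ h
    simp only [mem_boxTriples] at h ⊢
    omega
  · rintro ⟨i, j, k⟩ h
    simp only [mem_boxTriples] at h ⊢
    omega
  all_goals
    rintro ⟨i, j, k⟩ h
    simp only [mem_boxTriples] at h
  · simp only [Prod.mk.injEq]
    omega
  · simp only [Prod.mk.injEq]
    omega
  · congr 1
    simp only [Prod.mk.injEq]
    omega

/-- If `g` varies to first order in steps of `N`, and is odd about `N` up to factors of `m`, then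
the sum over triples is multiplied by `m` when `N` is. -/
theorem tripleSum_mul {R : Type*} [CommRing R] {g h : ℕ → R} {m N : ℕ} (hN : 0 < N) (hm : 2 ≤ m)
    (hodd : Odd m) (hNN : (N : R) * N = 0) (hmN : (m : R) * N = 0) (hg : ∀ x, g (N * x) = 0)
    (hstep : ∀ a, 0 < a → a < N → ∀ x, g (a + N * x) = g a - N * x * h a)
    (hrefl : ∀ a, 0 < a → a < N → (m : R) * g (N - a) = -(m * g a)) :
    tripleSum g (m * N) = m * tripleSum g N := by
  obtain ⟨l, hl⟩ := hodd
  have hterm : ∀ s n : ℕ, ∀ hn : m ∣ (triples n).card,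
      ∑ t ∈ boxTriples N (s * N), ∑ x ∈ triples n,
        g (t.1 + N * x.1) * g (t.2.1 + N * x.2.1) * g (t.2.2 + N * x.2.2) =
      (triples n).card * ∑ t ∈ boxTriples N (s * N), g t.1 * g t.2.1 * g t.2.2 := by
    intro s n hn
    set X : R := ∑ x ∈ triples n, (x.1 : R) with hX
    have hX1 : ∑ x ∈ triples n, (x.2.1 : R) = X := (sum_triples_swap n fun t => (t.1 : R)).symm
    have hX2 : ∑ x ∈ triples n, (x.2.2 : R) = X := (sum_triples_swap' n fun t => (t.1 : R)).symm
    -- By symmetry 3X is `n` times the number of triples, a multiple of `m`, and mN = 0.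
    have h3X : (N : R) * (3 * X) = 0 := by
      have h3 : ((3 * ∑ t ∈ triples n, t.1 : ℕ) : R) = ((n * (triples n).card : ℕ) : R) :=
        congrArg _ (three_mul_sum_triples_fst n)
      obtain ⟨c, hc⟩ := hn
      rw [hc] at h3
      push_cast at h3
      rw [hX, h3]
      linear_combination (n * c : R) * hmN
    have hinner : ∀ t ∈ boxTriples N (s * N), ∑ x ∈ triples n,
        g (t.1 + N * x.1) * g (t.2.1 + N * x.2.1) * g (t.2.2 + N * x.2.2) =
        (triples n).card * (g t.1 * g t.2.1 * g t.2.2) -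
          N * X * (h t.1 * g t.2.1 * g t.2.2 + g t.1 * h t.2.1 * g t.2.2
            + g t.1 * g t.2.1 * h t.2.2) := by
      intro t ht
      obtain ⟨-, h1, h2, h3⟩ := mem_boxTriples.1 ht
      have : ∀ x ∈ triples n,
          g (t.1 + N * x.1) * g (t.2.1 + N * x.2.1) * g (t.2.2 + N * x.2.2) =
          g t.1 * g t.2.1 * g t.2.2 - ((x.1 : R) * (N * (h t.1 * g t.2.1 * g t.2.2)) +
            (x.2.1 : R) * (N * (g t.1 * h t.2.1 * g t.2.2)) +
            (x.2.2 : R) * (N * (g t.1 * g t.2.1 * h t.2.2))) := by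
        intro x _
        rw [hstep _ h1.1 h1.2, hstep _ h2.1 h2.2, hstep _ h3.1 h3.2]
        -- Only terms of order at least 2 in `N` remain, and N² = 0.
        linear_combination (x.1 * x.2.1 * h t.1 * h t.2.1 * g t.2.2
          + x.1 * x.2.2 * h t.1 * g t.2.1 * h t.2.2
          + x.2.1 * x.2.2 * g t.1 * h t.2.1 * h t.2.2
          - N * x.1 * x.2.1 * x.2.2 * h t.1 * h t.2.1 * h t.2.2) * hNN
      rw [Finset.sum_congr rfl this, Finset.sum_sub_distrib, Finset.sum_add_distrib,
        Finset.sum_add_distrib, Finset.sum_const, nsmul_eq_mul, ← Finset.sum_mul, ← Finset.sum_mul,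
        ← Finset.sum_mul, hX1, hX2]
      ring
    rw [Finset.sum_congr rfl hinner, Finset.sum_sub_distrib, ← Finset.mul_sum, ← Finset.mul_sum,
      Finset.sum_add_distrib, Finset.sum_add_distrib]
    have e1 := sum_boxTriples_swap N (s * N) fun t => h t.1 * g t.2.1 * g t.2.2
    have e2 := sum_boxTriples_swap' N (s * N) fun t => h t.1 * g t.2.1 * g t.2.2
    have e1' : ∑ t ∈ boxTriples N (s * N), g t.1 * h t.2.1 * g t.2.2 =
        ∑ t ∈ boxTriples N (s * N), h t.1 * g t.2.1 * g t.2.2 := by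
      rw [e1]
      exact Finset.sum_congr rfl fun t _ => by ring
    have e2' : ∑ t ∈ boxTriples N (s * N), g t.1 * g t.2.1 * h t.2.2 =
        ∑ t ∈ boxTriples N (s * N), h t.1 * g t.2.1 * g t.2.2 := by
      rw [e2]
      exact Finset.sum_congr rfl fun t _ => by ring
    rw [e1', e2']
    linear_combination (-∑ t ∈ boxTriples N (s * N), h t.1 * g t.2.1 * g t.2.2) * h3X
  -- With m = 2l + 1, the two counts are m(l + 1) and ml. Both contain `m`, which `hterm` and
  -- `hrefl` need, and they differ by `m`.
  have hc1 : (triples (m - 1)).card = m * (l + 1) := by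
    have h2 := two_mul_card_triples (m - 1)
    rw [show m - 1 + 1 = m by omega, show m - 1 + 2 = 2 * (l + 1) by omega] at h2
    linarith
  have hc2 : (triples (m - 2)).card = m * l := by
    have h2 := two_mul_card_triples (m - 2)
    rw [show m - 2 + 2 = m by omega, show m - 2 + 1 = 2 * l by omega] at h2
    linarith
  have hA2 : (m : R) * ∑ t ∈ boxTriples N (2 * N), g t.1 * g t.2.1 * g t.2.2 =
      -(m * ∑ t ∈ boxTriples N N, g t.1 * g t.2.1 * g t.2.2) := by
    rw [sum_boxTriples_two_mul N fun t => g t.1 * g t.2.1 * g t.2.2, Finset.mul_sum,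
      Finset.mul_sum, ← Finset.sum_neg_distrib]
    refine Finset.sum_congr rfl fun t ht => ?_
    obtain ⟨-, h1, h2, h3⟩ := mem_boxTriples.1 ht
    have r1 := hrefl _ h1.1 h1.2
    have r2 := hrefl _ h2.1 h2.2
    have r3 := hrefl _ h3.1 h3.2
    linear_combination g (N - t.2.1) * g (N - t.2.2) * r1 - g t.1 * g (N - t.2.2) * r2
      + g t.1 * g t.2.1 * r3
  rw [tripleSum_mul_eq hN hm hg, Finset.sum_pair (by norm_num),
    hterm 1 _ (hc1 ▸ dvd_mul_right _ _), hterm 2 _ (hc2 ▸ dvd_mul_right _ _), hc1, hc2, one_mul,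
    tripleSum_eq_sum_boxTriples N (by simpa using hg 0)]
  push_cast
  linear_combination (l : R) * hA2

/-! ### Reduction to Z(pq) modulo p -/

theorem coprimeInv_mul_self {m n i : ℕ} (hi : i.Coprime n) (hm : i.Coprime m) :
    (i : ZMod m) * coprimeInv m n i = 1 := by
  rw [coprimeInv, if_pos hi, ZMod.coe_mul_inv_eq_one i hm]

theorem coprimeInv_of_not_coprime {m n i : ℕ} (hi : ¬ i.Coprime n) : coprimeInv m n i = 0 :=
  if_neg hi

/-- Multiplying `n` by an odd `m` with no new prime factors multiplies `harmonicZ n` by `m`. -/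
theorem ratModEq_harmonicZ_mul {M m N : ℕ} (hN : 1 < N) (hm : 2 ≤ m) (hodd : Odd m)
    (hNM : ∀ i : ℕ, i.Coprime N → i.Coprime M) (hNm : ∀ i : ℕ, i.Coprime N → i.Coprime m)
    (hNN : M ∣ N * N) (hmN : M ∣ m * N) :
    RatModEq M (harmonicZ (m * N)) (m * harmonicZ N) := by
  have hcop : ∀ i : ℕ, i.Coprime (m * N) ↔ i.Coprime N := fun i =>
    ⟨fun h => h.of_dvd_right (dvd_mul_left N m), fun h => (hNm i h).mul_right h⟩
  have hfun : coprimeInv M (m * N) = coprimeInv M N := by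
    funext i
    simp only [coprimeInv, hcop]
  have h1 := reducesTo_harmonicZ (m := M) (fun i hi => hNM i ((hcop i).1 hi))
    (show 1 < m * N by nlinarith)
  have h2 := (ReducesTo.natCast M m).mul (reducesTo_harmonicZ hNM hN)
  rw [hfun] at h1
  have hNN' : (N : ZMod M) * N = 0 := by
    exact_mod_cast (ZMod.natCast_eq_zero_iff (N * N) M).2 hNN
  have hmN' : (m : ZMod M) * N = 0 := by
    exact_mod_cast (ZMod.natCast_eq_zero_iff (m * N) M).2 hmN
  refine ratModEq_iff.2 ⟨_, h1, ?_⟩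
  -- Modulo N², 1/(a + Nx) = 1/a - Nx/a², hence this choice of `h`.
  rw [tripleSum_mul (g := coprimeInv M N) (h := fun a => coprimeInv M N a ^ 2) (by omega) hm hodd
    hNN' hmN']
  · exact h2
  · intro x
    refine coprimeInv_of_not_coprime fun h => ?_
    have := Nat.Coprime.coprime_mul_right h
    rw [Nat.coprime_self] at this
    omega
  · intro a _ _ x
    have hiff : (a + N * x).Coprime N ↔ a.Coprime N := by simp
    by_cases ha : a.Coprime N
    · have e1 := coprimeInv_mul_self ha (hNM a ha)
      have e2 := coprimeInv_mul_self (hiff.2 ha) (hNM _ (hiff.2 ha))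
      push_cast at e2
      linear_combination (-coprimeInv M N (a + N * x) + N * x * coprimeInv M N a *
        coprimeInv M N (a + N * x)) * e1 +
        (coprimeInv M N a - N * x * coprimeInv M N a ^ 2) * e2 +
        (coprimeInv M N a ^ 2 * coprimeInv M N (a + N * x) * x ^ 2) * hNN'
    · rw [coprimeInv_of_not_coprime ha, coprimeInv_of_not_coprime (mt hiff.1 ha)]
      simp
  -- 1/(N - a) + 1/a = N/(a(N - a)), which `m` kills.
  · intro a _ haN
    have hiff : (N - a).Coprime N ↔ a.Coprime N := Nat.coprime_self_sub_left haN.le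
    by_cases ha : a.Coprime N
    · have e1 := coprimeInv_mul_self ha (hNM a ha)
      have e2 := coprimeInv_mul_self (hiff.2 ha) (hNM _ (hiff.2 ha))
      rw [Nat.cast_sub haN.le] at e2
      linear_combination (-m * coprimeInv M N (N - a)) * e1 - m * coprimeInv M N a * e2 +
        coprimeInv M N a * coprimeInv M N (N - a) * hmN'
    · rw [coprimeInv_of_not_coprime ha, coprimeInv_of_not_coprime (mt hiff.1 ha)]
      simp

theorem ratModEq_harmonicZ_prime_mul_pow {p q : ℕ} (hp : p.Prime) (hq : q.Prime) (hq2 : Odd q)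
    {b : ℕ} (hb : 0 < b) :
    RatModEq p (harmonicZ (p * q ^ b)) ((q : ℚ) ^ (b - 1) * harmonicZ (p * q)) := by
  induction b, hb using Nat.le_induction with
  | base =>
    obtain ⟨r, hr⟩ : ∃ r, ReducesTo p (harmonicZ (p * q)) r :=
      ⟨_, reducesTo_harmonicZ (fun i hi => hi.of_dvd_right (dvd_mul_right _ _))
        (by nlinarith [hp.two_le, hq.two_le])⟩
    refine ratModEq_iff.2 ⟨r, ?_, ?_⟩ <;> simpa using hr
  | succ b hb ih =>
    have hb' : b ≠ 0 := by omega
    have h := ratModEq_harmonicZ_mul (M := p) (m := q) (N := p * q ^ b)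
      (by nlinarith [hp.two_le, Nat.one_le_pow b q hq.pos]) hq.two_le hq2
      (fun i hi => hi.of_dvd_right (dvd_mul_right _ _))
      (fun i hi => hi.of_dvd_right ((dvd_pow_self q hb').mul_left _))
      ⟨q ^ b * (p * q ^ b), by ring⟩ ⟨q * q ^ b, by ring⟩
    have h2 := h.trans (ih.natCast_mul q)
    have e1 : q * (p * q ^ b) = p * q ^ (b + 1) := by ring
    have e2 : (q : ℚ) * ((q : ℚ) ^ (b - 1) * harmonicZ (p * q)) =
        (q : ℚ) ^ (b + 1 - 1) * harmonicZ (p * q) := by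
      obtain ⟨c, rfl⟩ : ∃ c, b = c + 1 := ⟨b - 1, by omega⟩
      simp only [Nat.add_sub_cancel]
      ring
    rwa [e1, e2] at h2

/-- Each new factor `p` of n also raises the modulus: p times a congruence mod `p ^ a` is one mod `p
^ (a + 1)`, and `p ^ (a + 1)` divides N² because `a ≥ 1`. -/
theorem ratModEq_harmonicZ_pow_mul_pow {p q : ℕ} (hp : p.Prime) (hq : q.Prime) (hp2 : Odd p)
    (hq2 : Odd q) {a b : ℕ} (ha : 0 < a) (hb : 0 < b) {C : ℚ}
    (hC : RatModEq p (harmonicZ (p * q)) C) :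
    RatModEq (p ^ a) (harmonicZ (p ^ a * q ^ b)) ((p : ℚ) ^ (a - 1) * ((q : ℚ) ^ (b - 1) * C)) := by
  induction a, ha using Nat.le_induction with
  | base =>
    have h := (ratModEq_harmonicZ_prime_mul_pow hp hq hq2 hb).trans
      (by simpa using hC.natCast_mul (q ^ (b - 1)))
    simpa using h
  | succ a ha ih =>
    have ha' : a ≠ 0 := by omega
    have hpow : ∀ i : ℕ, i.Coprime (p ^ a * q ^ b) → i.Coprime p := fun i hi =>
      hi.of_dvd_right ((dvd_pow_self p ha').mul_right _)
    have h := ratModEq_harmonicZ_mul (M := p ^ a * p) (m := p) (N := p ^ a * q ^ b)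
      (by
        have h1 := Nat.le_self_pow ha' p
        have h2 := Nat.one_le_pow b q hq.pos
        nlinarith [hp.two_le]) hp.two_le hp2
      (fun i hi => (((hpow i hi).pow_right a).mul_right (hpow i hi))) hpow
      (by
        obtain ⟨c, rfl⟩ : ∃ c, a = c + 1 := ⟨a - 1, by omega⟩
        exact ⟨p ^ c * q ^ b * q ^ b, by ring⟩) ⟨q ^ b, by ring⟩
    have h2 := h.trans (ih.natCast_mul_lift (dvd_pow_self p ha'))
    have e1 : p * (p ^ a * q ^ b) = p ^ (a + 1) * q ^ b := by ring
    have e2 : (p : ℚ) * ((p : ℚ) ^ (a - 1) * ((q : ℚ) ^ (b - 1) * C)) =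
        (p : ℚ) ^ (a + 1 - 1) * ((q : ℚ) ^ (b - 1) * C) := by
      obtain ⟨c, rfl⟩ : ∃ c, a = c + 1 := ⟨a - 1, by omega⟩
      simp only [Nat.add_sub_cancel]
      ring
    rwa [e1, e2, ← pow_succ] at h2

/-! ### Z(pq) in `ZMod p` through harmonic and floor sums -/

section PrimeField

variable {p : ℕ} [Fact p.Prime]

theorem sum_range_natCast_zmod {M : Type*} [AddCommMonoid M] (f : ZMod p → M) :
    ∑ i ∈ Finset.range p, f i = ∑ x, f x := by
  refine Finset.sum_nbij' (fun i => (i : ZMod p)) ZMod.val ?_ ?_ ?_ ?_ ?_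
  · simp
  · intro x _
    exact Finset.mem_range.2 (ZMod.val_lt x)
  · intro i hi
    exact ZMod.val_cast_of_lt (Finset.mem_range.1 hi)
  · simp
  · simp

theorem sum_range_add_mul_natCast_zmod {M : Type*} [AddCommMonoid M] (f : ZMod p → M) (a k : ℕ) :
    ∑ i ∈ Finset.range (a + p * k), f i = ∑ i ∈ Finset.range a, f i + k • ∑ x, f x := by
  have h : ∀ k, ∑ i ∈ Finset.range (p * k), f i = k • ∑ x, f x := by
    intro k
    induction k with
    | zero => simp
    | succ k ih =>
      rw [mul_add, mul_one, Finset.sum_range_add, ih, succ_nsmul, ← sum_range_natCast_zmod]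
      simp
  rw [add_comm, Finset.sum_range_add, h, add_comm]
  simp

theorem sum_range_mul_mod {M : Type*} [AddCommMonoid M] {q : ℕ} (hq : q.Coprime p) (f : ℕ → M) :
    ∑ i ∈ Finset.range p, f (q * i % p) = ∑ i ∈ Finset.range p, f i := by
  have h1 : ∑ i ∈ Finset.range p, f (q * i % p) =
      ∑ i ∈ Finset.range p, f ((q * (i : ZMod p)).val) :=
    Finset.sum_congr rfl fun i _ => by
      rw [← ZMod.val_natCast, Nat.cast_mul]
  have h2 : ∑ i ∈ Finset.range p, f i = ∑ i ∈ Finset.range p, f ((i : ZMod p).val) :=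
    Finset.sum_congr rfl fun i hi => by rw [ZMod.val_cast_of_lt (Finset.mem_range.1 hi)]
  rw [h1, h2, sum_range_natCast_zmod fun x : ZMod p => f x.val,
    sum_range_natCast_zmod fun x : ZMod p => f ((q : ZMod p) * x).val]
  have hq0 : (q : ZMod p) ≠ 0 := ((ZMod.unitOfCoprime q hq).isUnit).ne_zero
  exact Equiv.sum_comp (Equiv.mulLeft₀ (q : ZMod p) hq0) fun x => f x.val

theorem natCast_zmod_ne_zero {i : ℕ} (h0 : 0 < i) (hi : i < p) : (i : ZMod p) ≠ 0 := by
  rw [Ne, ZMod.natCast_eq_zero_iff]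
  exact Nat.not_dvd_of_pos_of_lt h0 hi

theorem two_ne_zero_zmod (hp2 : Odd p) : (2 : ZMod p) ≠ 0 := by
  have h2 := (Fact.out : p.Prime).two_le
  have h : p ≠ 2 := by
    rintro rfl
    exact absurd hp2 (by decide)
  exact_mod_cast natCast_zmod_ne_zero (p := p) (i := 2) (by omega) (by omega)

theorem sum_inv_zmod (hp2 : Odd p) : ∑ x : ZMod p, x⁻¹ = 0 := by
  have h := Equiv.sum_comp (Equiv.neg (ZMod p)) fun x => x⁻¹
  simp only [Equiv.neg_apply, inv_neg, Finset.sum_neg_distrib] at h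
  have h2 : (2 : ZMod p) * ∑ x : ZMod p, x⁻¹ = 0 := by linear_combination -h
  exact (mul_eq_zero.1 h2).resolve_left (two_ne_zero_zmod hp2)

theorem inv_eq_pow_sub_two (hp2 : Odd p) (x : ZMod p) : x⁻¹ = x ^ (p - 2) := by
  have h2 := (Fact.out : p.Prime).two_le
  have h3 : p ≠ 2 := by
    rintro rfl
    exact absurd hp2 (by decide)
  rcases eq_or_ne x 0 with rfl | hx
  · rw [inv_zero, zero_pow (by omega)]
  · rw [inv_eq_iff_eq_inv, eq_comm]
    refine inv_eq_of_mul_eq_one_left ?_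
    rw [← pow_succ', show p - 2 + 1 = p - 1 by omega, ZMod.pow_card_sub_one_eq_one hx]

variable (p) in
/-- The harmonic sum `∑ 1 / j` over `j < n`, in `ZMod p`, where `1 / 0 = 0`. -/
def harmonicMod (n : ℕ) : ZMod p := ∑ j ∈ Finset.range n, (j : ZMod p)⁻¹

variable (p) in
/-- The sum of `1 / (j * k)` over `j + k = n`, in `ZMod p`, where `1 / 0 = 0`. -/
def pairSumMod (n : ℕ) : ZMod p :=
  ∑ x ∈ Finset.HasAntidiagonal.antidiagonal n, (x.1 : ZMod p)⁻¹ * (x.2 : ZMod p)⁻¹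

/-- Partial fractions: 1/(jk) = (1/j + 1/k)/(j + k). -/
theorem pairSumMod_add_mul (hp2 : Odd p) {r : ℕ} (h0 : 0 < r) (hr : r < p) (f : ℕ) :
    pairSumMod p (r + p * f) =
      2 * (r : ZMod p)⁻¹ * (harmonicMod p r - f * (r : ZMod p)⁻¹) := by
  set L := r + p * f with hL
  have hLr : (L : ZMod p) = r := by simp [hL]
  have hr0 := natCast_zmod_ne_zero h0 hr
  -- φ(j) is 1/k, set to 0 at j = 0 because those pairs contribute 0. Over a full period it sums to
  -- -1/r: all inverses sum to 0, and 1/r is omitted.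
  set φ : ZMod p → ZMod p := fun x => if x = 0 then 0 else (r - x)⁻¹ with hφ
  have hterm : ∀ x ∈ Finset.HasAntidiagonal.antidiagonal L,
      (x.1 : ZMod p)⁻¹ * (x.2 : ZMod p)⁻¹ = (r : ZMod p)⁻¹ * (φ x.1 + φ x.2) := by
    rintro ⟨j, k⟩ hjk
    rw [Finset.HasAntidiagonal.mem_antidiagonal] at hjk
    have hsum : (j : ZMod p) + k = r := by rw [← hLr, ← hjk]; simp
    have ej : (r : ZMod p) - j = k := by rw [← hsum]; ring
    have ek : (r : ZMod p) - k = j := by rw [← hsum]; ring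
    simp only [hφ, ej, ek]
    rcases eq_or_ne (j : ZMod p) 0 with hj | hj
    · simp [hj]
    rcases eq_or_ne (k : ZMod p) 0 with hk | hk
    · simp [hk]
    rw [if_neg hj, if_neg hk]
    rw [← hsum] at hr0 ⊢
    field_simp
  have hφsum : ∑ x, φ x = -(r : ZMod p)⁻¹ := by
    have h1 : ∀ x, φ x = ((r : ZMod p) - x)⁻¹ - if x = 0 then (r : ZMod p)⁻¹ else 0 := by
      intro x
      by_cases hx : x = 0 <;> simp [hφ, hx]
    have h2 := Equiv.sum_comp (Equiv.subLeft (r : ZMod p)) fun x => x⁻¹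
    simp only [Equiv.subLeft_apply] at h2
    rw [Finset.sum_congr rfl fun x _ => h1 x, Finset.sum_sub_distrib, h2, sum_inv_zmod hp2]
    simp
  have hφr : ∑ k ∈ Finset.range (r + 1), φ k = harmonicMod p r := by
    rw [Finset.sum_range_succ', harmonicMod, ← Finset.sum_range_reflect]
    have h00 : φ ((0 : ℕ) : ZMod p) = 0 := by simp [hφ]
    rw [h00, add_zero]
    refine Finset.sum_congr rfl fun k hk => ?_
    rw [Finset.mem_range] at hk
    have hne := natCast_zmod_ne_zero (p := p) (i := r - 1 - k + 1) (by omega) (by omega)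
    simp only [hφ, if_neg hne]
    congr 1
    rw [show r - 1 - k + 1 = r - k by omega, Nat.cast_sub hk.le]
    ring
  have hφL : ∑ x ∈ Finset.HasAntidiagonal.antidiagonal L, φ x.1 =
      harmonicMod p r - f * (r : ZMod p)⁻¹ := by
    rw [Finset.Nat.sum_antidiagonal_eq_sum_range_succ_mk, hL,
      -- The range is `f` full periods and the initial segment 0, ..., r.
      show (r + p * f).succ = (r + 1) + p * f by omega, sum_range_add_mul_natCast_zmod, hφr,
      hφsum, nsmul_eq_mul]
    ring
  have hφL' : ∑ x ∈ Finset.HasAntidiagonal.antidiagonal L, φ x.2 =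
      ∑ x ∈ Finset.HasAntidiagonal.antidiagonal L, φ x.1 :=
    Finset.Nat.sum_antidiagonal_swap (f := fun x : ℕ × ℕ => φ x.1)
  rw [pairSumMod, Finset.sum_congr rfl hterm, ← Finset.mul_sum, Finset.sum_add_distrib, hφL', hφL]
  ring

variable (p) in
/-- The sum of `1 / (i * i) * (1 / j)` over `j < i < p`, in `ZMod p`. -/
def doubleHarmonicMod : ZMod p :=
  ∑ i ∈ Finset.range p, ((i : ZMod p)⁻¹) ^ 2 * harmonicMod p i

theorem inv_natCast_sub_of_dvd {i n : ℕ} (hi : i ≤ n) (hn : p ∣ n) :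
    ((n - i : ℕ) : ZMod p)⁻¹ = -(i : ZMod p)⁻¹ := by
  rw [Nat.cast_sub hi, (ZMod.natCast_eq_zero_iff n p).2 hn, zero_sub, inv_neg]

/-- Fix the first entry as p - i; its inverse is -1/i, and the other two contribute 2/i times a
harmonic sum. -/
theorem tripleSum_inv_prime (hp2 : Odd p) :
    tripleSum (fun i => (i : ZMod p)⁻¹) p = -2 * doubleHarmonicMod p := by
  have h1 : tripleSum (fun i => (i : ZMod p)⁻¹) p =
      ∑ i ∈ Finset.range (p + 1), (i : ZMod p)⁻¹ * pairSumMod p (p - i) := by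
    rw [tripleSum, sum_triples]
    simp only [pairSumMod, Finset.mul_sum, mul_assoc]
  rw [h1, ← Finset.sum_range_reflect, Finset.sum_range_succ, doubleHarmonicMod, Finset.mul_sum]
  simp only [Nat.add_sub_cancel, Nat.sub_self, Nat.cast_zero, inv_zero, zero_mul, add_zero]
  refine Finset.sum_congr rfl fun i hi => ?_
  rw [Finset.mem_range] at hi
  rw [Nat.sub_sub_self hi.le, inv_natCast_sub_of_dvd hi.le dvd_rfl]
  rcases Nat.eq_zero_or_pos i with rfl | h0
  · simp
  · have h := pairSumMod_add_mul hp2 h0 hi 0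
    simp only [mul_zero, add_zero, Nat.cast_zero, zero_mul, sub_zero] at h
    rw [h]
    ring

variable (p) in
/-- The sum of `⌊q * i / p⌋ / (q * i) ^ 3` over `i < p`, in `ZMod p`. -/
def floorSumMod (q : ℕ) : ZMod p :=
  ∑ i ∈ Finset.range p, ((q * i / p : ℕ) : ZMod p) * ((q * i : ZMod p)⁻¹) ^ 3

/-- Write qi = r + p⌊qi/p⌋. The residues r permute those of i, giving the double harmonic sum; the
quotients give the floor sum. -/
theorem sum_inv_mul_pairSumMod (hp2 : Odd p) {q : ℕ} (hq : q.Coprime p) :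
    ∑ i ∈ Finset.range (p + 1), ((q * i : ℕ) : ZMod p)⁻¹ * pairSumMod p (q * (p - i)) =
      -2 * (doubleHarmonicMod p - floorSumMod p q) := by
  have hperm := sum_range_mul_mod hq fun i => ((i : ZMod p)⁻¹) ^ 2 * harmonicMod p i
  rw [← Finset.sum_range_reflect, Finset.sum_range_succ, doubleHarmonicMod, ← hperm, floorSumMod,
    ← Finset.sum_sub_distrib, Finset.mul_sum]
  simp only [Nat.add_sub_cancel, Nat.sub_self, mul_zero, Nat.cast_zero, inv_zero, zero_mul,
    add_zero]
  refine Finset.sum_congr rfl fun i hi => ?_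
  rw [Finset.mem_range] at hi
  rw [Nat.sub_sub_self hi.le, Nat.mul_sub,
    inv_natCast_sub_of_dvd (Nat.mul_le_mul_left q hi.le) (dvd_mul_left p q)]
  have hmod : ((q * i : ℕ) : ZMod p) = ((q * i % p : ℕ) : ZMod p) := by simp
  have hcast : (q : ZMod p) * i = ((q * i % p : ℕ) : ZMod p) := by rw [← hmod, Nat.cast_mul]
  rw [hcast, hmod]
  rcases Nat.eq_zero_or_pos (q * i % p) with h0 | h0
  · simp [h0]
  · have h := pairSumMod_add_mul hp2 h0 (Nat.mod_lt _ (Fact.out : p.Prime).pos) (q * i / p)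
    rw [Nat.mod_add_div] at h
    rw [h]
    ring

theorem sum_triples_inv_fst_dvd {q : ℕ} (hq : 0 < q) :
    ∑ t ∈ triples (q * p), (if q ∣ t.1 then (t.1 : ZMod p)⁻¹ else 0) *
      (t.2.1 : ZMod p)⁻¹ * (t.2.2 : ZMod p)⁻¹ =
    ∑ i ∈ Finset.range (p + 1), ((q * i : ℕ) : ZMod p)⁻¹ * pairSumMod p (q * (p - i)) := by
  rw [sum_triples]
  have h1 : ∀ i, ∑ x ∈ Finset.HasAntidiagonal.antidiagonal (q * p - i),
      (if q ∣ i then (i : ZMod p)⁻¹ else 0) * (x.1 : ZMod p)⁻¹ * (x.2 : ZMod p)⁻¹ =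
      if q ∣ i then (i : ZMod p)⁻¹ * pairSumMod p (q * p - i) else 0 := by
    intro i
    split_ifs
    · simp only [pairSumMod, Finset.mul_sum, mul_assoc]
    · simp
  rw [Finset.sum_congr rfl fun i _ => h1 i, ← Finset.sum_filter]
  symm
  refine Finset.sum_nbij' (fun i => q * i) (fun i => i / q) ?_ ?_ ?_ ?_ ?_
  · intro i hi
    simp only [Finset.mem_range, Finset.mem_filter] at hi ⊢
    exact ⟨Nat.lt_succ_of_le (Nat.mul_le_mul_left q (by omega)), dvd_mul_right _ _⟩
  · intro i hi
    simp only [Finset.mem_range, Finset.mem_filter] at hi ⊢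
    exact Nat.lt_succ_of_le (Nat.div_le_of_le_mul (by omega))
  · intro i _
    exact Nat.mul_div_cancel_left i hq
  · intro i hi
    simp only [Finset.mem_filter] at hi
    exact Nat.mul_div_cancel' hi.2
  · intro i _
    simp only [Nat.mul_sub]

theorem sum_triples_inv_dvd {q : ℕ} (hq : 0 < q) (n : ℕ) :
    tripleSum (fun i => if q ∣ i then (i : ZMod p)⁻¹ else 0) (q * n) =
      ((q : ZMod p)⁻¹) ^ 3 * tripleSum (fun i => (i : ZMod p)⁻¹) n := by
  rw [tripleSum, tripleSum, Finset.mul_sum]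
  have h : ∑ t ∈ (triples (q * n)).filter (fun t => q ∣ t.1 ∧ q ∣ t.2.1 ∧ q ∣ t.2.2),
      (if q ∣ t.1 then (t.1 : ZMod p)⁻¹ else 0) * (if q ∣ t.2.1 then (t.2.1 : ZMod p)⁻¹ else 0) *
        (if q ∣ t.2.2 then (t.2.2 : ZMod p)⁻¹ else 0) =
      ∑ t ∈ triples (q * n),
      (if q ∣ t.1 then (t.1 : ZMod p)⁻¹ else 0) * (if q ∣ t.2.1 then (t.2.1 : ZMod p)⁻¹ else 0) *
        (if q ∣ t.2.2 then (t.2.2 : ZMod p)⁻¹ else 0) := by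
    refine Finset.sum_subset (Finset.filter_subset _ _) fun t ht hnot => ?_
    rw [Finset.mem_filter] at hnot
    by_cases h1 : q ∣ t.1
    · by_cases h2 : q ∣ t.2.1
      · by_cases h3 : q ∣ t.2.2
        · exact absurd ⟨ht, h1, h2, h3⟩ hnot
        · simp [h3]
      · simp [h2]
    · simp [h1]
  rw [← h]
  symm
  refine Finset.sum_nbij' (fun t => (q * t.1, q * t.2.1, q * t.2.2))
    (fun t => (t.1 / q, t.2.1 / q, t.2.2 / q)) ?_ ?_ ?_ ?_ ?_
  · rintro ⟨i, j, k⟩ ht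
    simp only [mem_triples, Finset.mem_filter, dvd_mul_right, and_self, and_true] at ht ⊢
    rw [← ht]
    ring
  · rintro ⟨i, j, k⟩ ht
    simp only [mem_triples, Finset.mem_filter] at ht ⊢
    obtain ⟨hs, ⟨a, rfl⟩, ⟨b, rfl⟩, ⟨c, rfl⟩⟩ := ht
    simp only [Nat.mul_div_cancel_left _ hq]
    exact Nat.eq_of_mul_eq_mul_left hq (by linarith)
  · rintro ⟨i, j, k⟩ _
    simp [Nat.mul_div_cancel_left _ hq]
  · rintro ⟨i, j, k⟩ ht
    simp only [Finset.mem_filter] at ht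
    simp [Nat.mul_div_cancel' ht.2.1, Nat.mul_div_cancel' ht.2.2.1, Nat.mul_div_cancel' ht.2.2.2]
  · rintro ⟨i, j, k⟩ _
    simp only [dvd_mul_right, if_true, Nat.cast_mul, mul_inv]
    ring

/-- In `ZMod p` the inverse is p-periodic, so `tripleSum_mul` applies with N = p and `h = 0`. -/
theorem tripleSum_inv_mul {q : ℕ} (hq : 2 ≤ q) (hq2 : Odd q) :
    tripleSum (fun i => (i : ZMod p)⁻¹) (q * p) =
      q * tripleSum (fun i => (i : ZMod p)⁻¹) p := by
  refine tripleSum_mul (h := fun _ => 0) (Fact.out : p.Prime).pos hq hq2 (by simp) (by simp)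
    (by simp) (by simp) ?_
  intro a _ ha
  rw [inv_natCast_sub_of_dvd ha.le dvd_rfl, mul_neg]

/-- Inclusion-exclusion over the entries divisible by `q`: two such entries force the third. -/
theorem tripleSum_not_dvd {R : Type*} [CommRing R] (u : ℕ → R) {q n : ℕ} (hn : q ∣ n) :
    tripleSum (fun i => if q ∣ i then 0 else u i) n =
      tripleSum u n - 3 * ∑ t ∈ triples n, (if q ∣ t.1 then u t.1 else 0) * u t.2.1 * u t.2.2 +
        2 * tripleSum (fun i => if q ∣ i then u i else 0) n := by
  have e1 := sum_triples_swap n fun t => (if q ∣ t.1 then u t.1 else 0) * u t.2.1 * u t.2.2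
  have e2 := sum_triples_swap' n fun t => (if q ∣ t.1 then u t.1 else 0) * u t.2.1 * u t.2.2
  have e3 : tripleSum (fun i => if q ∣ i then 0 else u i) n =
      ∑ t ∈ triples n, (u t.1 * u t.2.1 * u t.2.2 -
        ((if q ∣ t.1 then u t.1 else 0) * u t.2.1 * u t.2.2 +
          (if q ∣ t.2.1 then u t.2.1 else 0) * u t.1 * u t.2.2 +
          (if q ∣ t.2.2 then u t.2.2 else 0) * u t.2.1 * u t.1) +
        2 * ((if q ∣ t.1 then u t.1 else 0) * (if q ∣ t.2.1 then u t.2.1 else 0) *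
          (if q ∣ t.2.2 then u t.2.2 else 0))) := by
    refine Finset.sum_congr rfl ?_
    rintro ⟨i, j, k⟩ ht
    rw [mem_triples] at ht
    subst ht
    -- Exactly two multiples of `q` cannot occur; with three the weights are 1 - 3 + 2 = 0, with one
    -- 1 - 1 = 0.
    by_cases hi : q ∣ i <;> by_cases hj : q ∣ j <;> by_cases hk : q ∣ k
    · simp only [hi, hj, hk, if_true]
      ring
    · exact absurd ((Nat.dvd_add_right (dvd_add hi hj)).1 hn) hk
    · rw [add_right_comm] at hn
      exact absurd ((Nat.dvd_add_right (dvd_add hi hk)).1 hn) hj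
    · simp only [hi, hj, hk, if_true, if_false]
      ring
    · rw [add_assoc] at hn
      exact absurd ((Nat.dvd_add_left (dvd_add hj hk)).1 hn) hi
    all_goals
      simp only [hi, hj, hk, if_true, if_false]
      ring
  rw [e3, Finset.sum_add_distrib, Finset.sum_sub_distrib, Finset.sum_add_distrib,
    Finset.sum_add_distrib, ← e1, ← e2, ← Finset.mul_sum]
  simp only [tripleSum]
  ring

theorem coprimeInv_mul_prime {q : ℕ} (hq : q.Prime) (i : ℕ) :
    coprimeInv p (p * q) i = if q ∣ i then 0 else (i : ZMod p)⁻¹ := by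
  have hq' : i.Coprime q ↔ ¬ q ∣ i := by rw [Nat.coprime_comm, hq.coprime_iff_not_dvd]
  have hp' : i.Coprime p ↔ ¬ p ∣ i := by
    rw [Nat.coprime_comm, (Fact.out : p.Prime).coprime_iff_not_dvd]
  simp only [coprimeInv, Nat.coprime_mul_iff_right, hq', hp']
  by_cases h1 : q ∣ i
  · simp [h1]
  · by_cases h2 : p ∣ i
    · simp [h1, h2, (ZMod.natCast_eq_zero_iff i p).2 h2]
    · simp [h1, h2]

/-- The three inclusion-exclusion terms are -2qD, 6(D - F) and -4q⁻³D. -/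
theorem tripleSum_coprimeInv_mul (hp2 : Odd p) {q : ℕ} (hq : q.Prime) (hq2 : Odd q)
    (hpq : q.Coprime p) :
    tripleSum (coprimeInv p (p * q)) (p * q) =
      (6 - 2 * q - 4 * ((q : ZMod p)⁻¹) ^ 3) * doubleHarmonicMod p - 6 * floorSumMod p q := by
  have h : coprimeInv p (p * q) = fun i => if q ∣ i then 0 else (i : ZMod p)⁻¹ :=
    funext (coprimeInv_mul_prime hq)
  rw [h, mul_comm p q, tripleSum_not_dvd _ (dvd_mul_right q p), sum_triples_inv_dvd hq.pos,
    sum_triples_inv_fst_dvd hq.pos, sum_inv_mul_pairSumMod hp2 hpq,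
    tripleSum_inv_mul hq.two_le hq2, tripleSum_inv_prime hp2]
  ring

end PrimeField

/-! ### Bernoulli numbers modulo p -/

section PrimeField

variable {p : ℕ} [Fact p.Prime]

theorem natCast_coprime_prime {d : ℕ} (h0 : 0 < d) (hd : d < p) : d.Coprime p := by
  rw [Nat.coprime_comm, (Fact.out : p.Prime).coprime_iff_not_dvd]
  exact Nat.not_dvd_of_pos_of_lt h0 hd

/-- The recurrence for B_n divides only by n + 1 < p. -/
theorem exists_reducesTo_bernoulli {n : ℕ} (hn : n < p - 1) :
    ∃ b : ZMod p, ReducesTo p (bernoulli n) b := by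
  induction n using Nat.strong_induction_on with
  | _ n ih =>
    have h := sum_bernoulli (n + 1)
    rw [Finset.sum_range_succ, Nat.choose_succ_self_right] at h
    have hB : bernoulli n = (((n + 1 : ℕ) : ℚ))⁻¹ * ((if n + 1 = 1 then (1 : ℕ) else (0 : ℕ) : ℕ) -
        ∑ k ∈ Finset.range n, ((n + 1).choose k : ℚ) * bernoulli k) := by
      have hne : ((n + 1 : ℕ) : ℚ) ≠ 0 := by positivity
      rw [eq_inv_mul_iff_mul_eq₀ hne]
      push_cast at h ⊢
      linear_combination h
    choose! b hb using fun k (hk : k < n) => ih k hk (by omega)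
    rw [hB]
    exact ⟨_, (ReducesTo.inv_natCast (natCast_coprime_prime (by omega) (by omega))
      (by omega)).mul ((ReducesTo.natCast p _).sub (ReducesTo.sum fun k hk =>
        (ReducesTo.natCast p _).mul (hb k (Finset.mem_range.1 hk))))⟩

theorem sum_pow_zmod {e : ℕ} (he : 0 < e) :
    ∑ x : ZMod p, x ^ e = if p - 1 ∣ e then -1 else 0 := by
  have h := FiniteField.sum_pow_units (ZMod p) e
  rw [ZMod.card] at h
  rw [← h, ← Finset.sum_sdiff ({0} : Finset (ZMod p)).subset_univ, Finset.sum_singleton,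
    zero_pow he.ne', add_zero]
  refine (Finset.sum_nbij (fun x : (ZMod p)ˣ => (x : ZMod p)) ?_ ?_ ?_ ?_).symm
  · simp
  · exact fun x _ y _ hxy => Units.ext hxy
  · intro x hx
    have hx0 : x ≠ 0 := by simpa using hx
    exact ⟨Units.mk0 x hx0, by simp, rfl⟩
  · simp

/-- By Fermat 1/j = j^(p-2), so Faulhaber's formula makes the harmonic sum a polynomial with
Bernoulli coefficients. After weighting by l⁻² and summing over l, only the exponent 2(p - 1)
survives, that is i = p - 3. -/
theorem doubleHarmonicMod_eq (hp2 : Odd p) {b : ZMod p}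
    (hb : ReducesTo p (bernoulli (p - 3)) b) : doubleHarmonicMod p = b := by
  have hp : p.Prime := Fact.out
  have hp3 : 3 ≤ p := by
    have := hp.two_le
    rcases hp2 with ⟨k, hk⟩
    omega
  choose! c hc using fun n (hn : n < p - 1) => exists_reducesTo_bernoulli (p := p) hn
  have hsub : (((p - 1 : ℕ) : ZMod p))⁻¹ = -1 := by
    rw [Nat.cast_sub (by omega)]
    simp [inv_neg]
  have hH : ∀ l, harmonicMod p l = -∑ i ∈ Finset.range (p - 1),
      c i * ((p - 1).choose i : ZMod p) * (l : ZMod p) ^ (p - 1 - i) := by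
    intro l
    have hF := sum_range_pow l (p - 2)
    rw [show p - 2 + 1 = p - 1 by omega] at hF
    have hcast : ((p - 2 : ℕ) : ℚ) + 1 = ((p - 1 : ℕ) : ℚ) := by
      rw [show p - 1 = p - 2 + 1 by omega]
      simp
    rw [hcast] at hF
    have h1 : ReducesTo p (∑ k ∈ Finset.range l, (k : ℚ) ^ (p - 2)) (harmonicMod p l) :=
      ReducesTo.sum fun k _ => by
        rw [inv_eq_pow_sub_two hp2]
        exact (ReducesTo.natCast p k).pow _
    have h2 : ReducesTo p (∑ i ∈ Finset.range (p - 1),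
        bernoulli i * ((p - 1).choose i) * (l : ℚ) ^ (p - 1 - i) / ((p - 1 : ℕ) : ℚ))
        (∑ i ∈ Finset.range (p - 1),
          c i * ((p - 1).choose i) * (l : ZMod p) ^ (p - 1 - i) * ((p - 1 : ℕ) : ZMod p)⁻¹) :=
      ReducesTo.sum fun i hi => by
        rw [div_eq_mul_inv]
        exact (((hc i (Finset.mem_range.1 hi)).mul (ReducesTo.natCast p _)).mul
          ((ReducesTo.natCast p l).pow _)).mul
          (ReducesTo.inv_natCast (natCast_coprime_prime (by omega) (by omega)) (by omega))
    rw [hF] at h1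
    rw [h1.unique h2, hsub, ← Finset.sum_mul]
    ring
  have h2 : doubleHarmonicMod p = -∑ i ∈ Finset.range (p - 1),
      c i * ((p - 1).choose i : ZMod p) * ∑ x : ZMod p, x ^ (2 * (p - 2) + (p - 1 - i)) := by
    simp only [doubleHarmonicMod, hH, mul_neg, Finset.sum_neg_distrib, Finset.mul_sum]
    rw [Finset.sum_comm]
    congr 1
    refine Finset.sum_congr rfl fun i _ => ?_
    rw [← Finset.mul_sum, ← sum_range_natCast_zmod, Finset.mul_sum]
    refine Finset.sum_congr rfl fun l _ => ?_
    rw [inv_eq_pow_sub_two hp2, pow_add, ← pow_mul, mul_comm (p - 2) 2]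
    ring
  have hchoose : ((p - 1).choose (p - 3) : ZMod p) = 1 := by
    have h := Nat.choose_symm (n := p - 1) (k := 2) (by omega)
    rw [show p - 1 - 2 = p - 3 by omega] at h
    have h4 : (p - 1).choose 2 * 2 = (p - 1) * (p - 2) := by
      rw [Nat.choose_two_right, show p - 1 - 1 = p - 2 by omega]
      refine Nat.div_mul_cancel (Dvd.dvd.mul_right ?_ _)
      obtain ⟨k, hk⟩ := hp2
      exact ⟨k, by omega⟩
    have h5 : ((p - 1).choose 2 : ZMod p) * 2 = (p - 1) * (p - 2) := by
      have := congrArg (Nat.cast : ℕ → ZMod p) h4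
      rw [Nat.cast_mul, Nat.cast_mul, Nat.cast_sub (by omega), Nat.cast_sub (by omega)] at this
      exact_mod_cast this
    rw [h]
    refine mul_right_cancel₀ (two_ne_zero_zmod hp2) ?_
    rw [h5, CharP.cast_eq_zero (ZMod p) p]
    ring
  have h3 : ∀ i ∈ Finset.range (p - 1), i ≠ p - 3 →
      c i * ((p - 1).choose i : ZMod p) * ∑ x : ZMod p, x ^ (2 * (p - 2) + (p - 1 - i)) = 0 := by
    intro i hi hne
    rw [Finset.mem_range] at hi
    rw [sum_pow_zmod (by omega), if_neg, mul_zero]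
    rintro ⟨k, hk⟩
    have h1 : 1 < k := by
      by_contra hcon
      have : (p - 1) * k ≤ (p - 1) * 1 := Nat.mul_le_mul_left _ (by omega)
      omega
    have h2 : k < 3 := by
      by_contra hcon
      have : (p - 1) * 3 ≤ (p - 1) * k := Nat.mul_le_mul_left _ (by omega)
      omega
    obtain rfl : k = 2 := by omega
    omega
  rw [h2, Finset.sum_eq_single_of_mem (p - 3) (Finset.mem_range.2 (by omega)) h3, hchoose,
    sum_pow_zmod (by omega), if_pos ⟨2, by omega⟩, (hc (p - 3) (by omega)).unique hb]
  ring

/-- In Faulhaber's formula the last term is pB_k, and all others contain p² with p-integral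
cofactors. -/
theorem exists_sum_range_pow_eq {k : ℕ} (hk : 0 < k) (hkp : k < p - 1) :
    ∃ (z : ℚ) (r : ZMod p), ReducesTo p z r ∧
      ∑ i ∈ Finset.range p, (i : ℚ) ^ k = p * bernoulli k + p ^ 2 * z := by
  choose! c hc using fun n (hn : n < p - 1) => exists_reducesTo_bernoulli (p := p) hn
  refine ⟨∑ i ∈ Finset.range k, bernoulli i * ((k + 1).choose i) * (p : ℚ) ^ (k - 1 - i) *
    ((k + 1 : ℕ) : ℚ)⁻¹, _, ReducesTo.sum (g := fun i => c i * ((k + 1).choose i : ZMod p) *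
      (p : ZMod p) ^ (k - 1 - i) * ((k + 1 : ℕ) : ZMod p)⁻¹) fun i hi => ?_, ?_⟩
  · have hi' := Finset.mem_range.1 hi
    exact (((hc i (by omega)).mul (ReducesTo.natCast p _)).mul ((ReducesTo.natCast p p).pow _)).mul
      (ReducesTo.inv_natCast (natCast_coprime_prime (by omega) (by omega)) (by omega))
  · have hne : (k : ℚ) + 1 ≠ 0 := by positivity
    rw [sum_range_pow, Finset.sum_range_succ, add_comm, Finset.mul_sum]
    congr 1
    · rw [Nat.choose_succ_self_right, show k + 1 - k = 1 by omega]
      push_cast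
      field_simp
    · refine Finset.sum_congr rfl fun i hi => ?_
      have hi' := Finset.mem_range.1 hi
      rw [show k + 1 - i = (k - 1 - i) + 2 by omega]
      push_cast
      field_simp
      ring

/-- Voronoi's congruence for Bernoulli numbers of index below `p - 1`. -/
theorem voronoi_congruence {q k : ℕ} (hq : q.Coprime p) (hk : 0 < k) (hkp : k < p - 1)
    {b : ZMod p} (hb : ReducesTo p (bernoulli k) b) :
    ((q : ZMod p) ^ k - 1) * b =
      k * ∑ i ∈ Finset.range p, ((q * i / p : ℕ) : ZMod p) * (q * i : ZMod p) ^ (k - 1) := by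
  have hp0 : (p : ℚ) ≠ 0 := by exact_mod_cast (Fact.out : p.Prime).ne_zero
  obtain ⟨z, r, hz, hsum⟩ := exists_sum_range_pow_eq hk hkp
  -- Expand (qi - p⌊qi/p⌋)^k modulo p².
  have hstep : ∀ i : ℕ, ∃ w : ℤ, ((q * i % p : ℕ) : ℤ) ^ k = (q * i : ℤ) ^ k -
      k * p * ((q * i / p : ℕ) * (q * i : ℤ) ^ (k - 1)) + p ^ 2 * w := by
    intro i
    obtain ⟨w, hw⟩ := Polynomial.powAddExpansion (q * i : ℤ) (-(p * (q * i / p : ℕ))) k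
    refine ⟨w * (q * i / p : ℕ) ^ 2, ?_⟩
    have h : ((q * i % p : ℕ) : ℤ) = (q * i : ℤ) + -(p * (q * i / p : ℕ)) := by
      have h2 : ((q * i % p : ℕ) : ℤ) + p * (q * i / p : ℕ) = q * i := by
        exact_mod_cast Nat.mod_add_div (q * i) p
      linear_combination h2
    rw [h, hw]
    ring
  choose w hw using hstep
  set Q : ℤ := ∑ i ∈ Finset.range p, ((q * i / p : ℕ) : ℤ) * (q * i : ℤ) ^ (k - 1) with hQ
  have hint : ∑ i ∈ Finset.range p, (i : ℤ) ^ k = q ^ k * ∑ i ∈ Finset.range p, (i : ℤ) ^ k -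
      k * p * Q + p ^ 2 * ∑ i ∈ Finset.range p, w i := by
    have h := sum_range_mul_mod hq fun i => (i : ℤ) ^ k
    nth_rewrite 1 [← h]
    rw [Finset.sum_congr rfl fun i _ => hw i, Finset.sum_add_distrib, Finset.sum_sub_distrib,
      ← Finset.mul_sum, ← Finset.mul_sum]
    simp only [mul_pow, ← Finset.mul_sum, hQ]
  -- Dividing by p in `ℚ` leaves p-integral terms to be reduced mod p.
  have hrat : ((q : ℚ) ^ k - 1) * (bernoulli k + p * z) - k * Q +
      p * ((∑ i ∈ Finset.range p, w i : ℤ) : ℚ) = 0 := by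
    have h := congrArg (Int.cast : ℤ → ℚ) hint
    push_cast at h
    rw [hsum] at h
    refine mul_left_cancel₀ hp0 ?_
    push_cast
    linear_combination -h
  have hred := (((((ReducesTo.natCast p q).pow k).sub (ReducesTo.natCast p 1)).mul
    (hb.add ((ReducesTo.natCast p p).mul hz))).sub
    ((ReducesTo.natCast p k).mul (ReducesTo.intCast p Q))).add
    ((ReducesTo.natCast p p).mul (ReducesTo.intCast p (∑ i ∈ Finset.range p, w i)))
  rw [Nat.cast_one, hrat] at hred
  have h0 := hred.unique (ReducesTo.natCast p 0)
  rw [CharP.cast_eq_zero (ZMod p) p] at h0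
  have hQ' : (Q : ZMod p) =
      ∑ i ∈ Finset.range p, ((q * i / p : ℕ) : ZMod p) * (q * i : ZMod p) ^ (k - 1) := by
    simp only [hQ, Int.cast_sum, Int.cast_mul, Int.cast_pow, Int.cast_natCast]
  rw [← hQ']
  push_cast at h0
  linear_combination h0

/-- Voronoi's congruence with k = p - 3: here k ≡ -3 and x^(k-1) = x⁻³ for x ≠ 0. -/
theorem three_mul_floorSumMod (hp2 : Odd p) {q : ℕ} (hq : q.Coprime p) {b : ZMod p}
    (hb : ReducesTo p (bernoulli (p - 3)) b) :
    3 * (q : ZMod p) ^ 2 * floorSumMod p q = (q ^ 2 - 1) * b := by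
  have hp : p.Prime := Fact.out
  have hq0 : (q : ZMod p) ≠ 0 := ((ZMod.unitOfCoprime q hq).isUnit).ne_zero
  have hfermat := ZMod.pow_card_sub_one_eq_one hq0
  -- For p = 3 the index k is 0, but both sides vanish since 3 = 0 and q² = 1.
  rcases eq_or_ne p 3 with rfl | h3
  · have e : (3 : ZMod 3) = 0 := rfl
    rw [show 3 - 1 = 2 from rfl] at hfermat
    rw [e, hfermat]
    ring
  have hp5 : 5 ≤ p := by
    have := hp.two_le
    rcases hp2 with ⟨k, hk⟩
    omega
  have hV := voronoi_congruence hq (k := p - 3) (by omega) (by omega) hb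
  have hfloor : floorSumMod p q = ∑ i ∈ Finset.range p, ((q * i / p : ℕ) : ZMod p) *
      (q * i : ZMod p) ^ (p - 3 - 1) := by
    refine Finset.sum_congr rfl fun i hi => ?_
    rcases Nat.eq_zero_or_pos i with rfl | h0
    · simp
    · have hne : (q : ZMod p) * i ≠ 0 :=
        mul_ne_zero hq0 (natCast_zmod_ne_zero h0 (Finset.mem_range.1 hi))
      congr 1
      rw [inv_pow, inv_eq_iff_eq_inv, eq_comm]
      refine inv_eq_of_mul_eq_one_left ?_
      rw [← pow_add, show 3 + (p - 3 - 1) = p - 1 by omega, ZMod.pow_card_sub_one_eq_one hne]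
  rw [← hfloor, Nat.cast_sub (by omega), CharP.cast_eq_zero (ZMod p) p] at hV
  have hq2 : (q : ZMod p) ^ 2 * q ^ (p - 3) = 1 := by
    rw [← pow_add, show 2 + (p - 3) = p - 1 by omega, hfermat]
  push_cast at hV
  linear_combination (q : ZMod p) ^ 2 * hV - b * hq2

end PrimeField

/-! ### Assembling the congruence -/

theorem ratModEq_harmonicZ_prime_mul_prime {p q : ℕ} (hp : p.Prime) (hq : q.Prime) (hp2 : Odd p)
    (hq2 : Odd q) (hpq : p ≠ q) :
    RatModEq p (harmonicZ (p * q))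
      (2 * (2 - (q : ℚ)) * (1 - 1 / (q : ℚ) ^ 3) * bernoulli (p - 3)) := by
  have : Fact p.Prime := ⟨hp⟩
  have hcop : q.Coprime p := (Nat.coprime_primes hq hp).2 hpq.symm
  have hp3 : 3 ≤ p := by
    have := hp.two_le
    rcases hp2 with ⟨k, hk⟩
    omega
  obtain ⟨b, hb⟩ := exists_reducesTo_bernoulli (p := p) (n := p - 3) (by omega)
  have h1 := reducesTo_harmonicZ (m := p) (n := p * q)
    (fun i hi => hi.of_dvd_right (dvd_mul_right _ _)) (by nlinarith [hq.two_le])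
  have h2 := (((ReducesTo.natCast p 2).mul ((ReducesTo.natCast p 2).sub
    (ReducesTo.natCast p q))).mul ((ReducesTo.natCast p 1).sub
    ((ReducesTo.inv_natCast hcop hq.ne_zero).pow 3))).mul hb
  refine ratModEq_iff.2 ⟨_, h1, ?_⟩
  have hq0 : (q : ZMod p) ≠ 0 := ((ZMod.unitOfCoprime q hcop).isUnit).ne_zero
  have hinv : (q : ZMod p) * (q : ZMod p)⁻¹ = 1 := mul_inv_cancel₀ hq0
  have hval : tripleSum (coprimeInv p (p * q)) (p * q) =
      ((2 : ℕ) : ZMod p) * (((2 : ℕ) : ZMod p) - q) * (((1 : ℕ) : ZMod p) - ((q : ZMod p)⁻¹) ^ 3)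
        * b := by
    rw [tripleSum_coprimeInv_mul hp2 hq hq2 hcop, doubleHarmonicMod_eq hp2 hb]
    have h3 := three_mul_floorSumMod hp2 hcop hb
    -- Only 6F is needed, so 3 is never inverted and p = 3 is included.
    have h4 : 3 * floorSumMod p q = (1 - ((q : ZMod p)⁻¹) ^ 2) * b := by
      field_simp
      linear_combination h3
    push_cast
    linear_combination (-2 : ZMod p) * h4 - 2 * ((q : ZMod p)⁻¹) ^ 2 * b * hinv
  rw [hval]
  convert h2 using 2
  push_cast
  rw [one_div, inv_pow]

theorem theorem2 (p q α β : ℕ) (hp : p.Prime) (hq : q.Prime) (hp2 : Odd p) (hq2 : Odd q)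
    (hpq : p ≠ q) (hα : 0 < α) (hβ : 0 < β) :
    RatModEq (p ^ α) (harmonicZ (p ^ α * q ^ β))
      (2 * (2 - (q : ℚ)) * (1 - 1 / (q : ℚ) ^ 3) * (p : ℚ) ^ (α - 1) * (q : ℚ) ^ (β - 1) *
        bernoulli (p - 3)) := by
  have h := ratModEq_harmonicZ_pow_mul_pow hp hq hp2 hq2 hα hβ
    (ratModEq_harmonicZ_prime_mul_prime hp hq hp2 hq2 hpq)
  convert h using 1
  ring
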